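/- Consider the first-order language with equality whose only non-logical symbol is the binary relation symbol $\in$, and the following sentences in it: - $\mathsf{W}$: $\forall x y\,\exists z\,\forall u\,[\,u\in z\leftrightarrow(u\in x\vee u=y)\,]$; - $\mathsf{D}$: $\forall x y\,\exists z\,\forall u\,[\,u\in z\leftrightarrow(u\in x\wedge u\neq y)\,]$; - $\mathsf{EXT}$: $\forall x y\,[\,\forall u\,(u\in x\leftrightarrow u\in y)\rightarrow x=y\,]$; - $\mathsf{BU}$: $\forall x y\,\exists z\,\forall u\,[\,u\in z\leftrightarrow(u\in x\vee u\in y)\,]$; - $\mathsf{BI}$: $\forall x y\,\exists z\,\forall u\,[\,u\in z\leftrightarrow(u\in x\wedge u\in y)\,]$. Let $\mathsf{WD}$ be the theory with axioms $\mathsf{W}$ and $\mathsf{D}$, and let adjunctive set theory $\mathsf{AS}$ be the theory with axioms $\exists x\,\forall y\,[\,y\notin x\,]$ and $\mathsf{W}$. A first-order theory $T$ is *parameter-free sequential* if there is a first-order formula $\varphi(x,y)$ in the language of $T$, with no free variables other than $x,y$, such that for every (nonempty) model $\mathcal M$ of $T$, with universe $M$, the structure $(M,R)$, where $R=\{(x,y)\in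 M^2:\mathcal M\models\varphi(x,y)\}$ interprets the symbol $\in$, is a model of $\mathsf{AS}$. **Corollary.** The theory $\mathsf{WD}+\mathsf{EXT}+\mathsf{BU}+\mathsf{BI}$ is not parameter-free sequential. In particular, $\mathsf{WD}$ is not parameter-free sequential. -/

import Mathlib

universe w

namespace WeakSet

open FirstOrder FirstOrder.Language

/-- The relation symbols of the language of set theory: one binary symbol `∈`. -/
inductive SetRel : ℕ → Type
  | mem : SetRel 2

/-- The first-order language (with equality) of set theory, with the single non-logical symbol `∈`. -/
def setLang : FirstOrder.Language.{0, 0} := ⟨fun _ => Empty, SetRel⟩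

/-- The atomic formula `t₁ ∈ t₂`. -/
def memF {α : Type} {n : ℕ} (t₁ t₂ : setLang.Term (α ⊕ Fin n)) : setLang.BoundedFormula α n :=
  Relations.boundedFormula₂ (L := setLang) SetRel.mem t₁ t₂

/-- The structure `(M, R)` for the language of set theory, in which `∈` is interpreted as `R`. -/
abbrev structureOf {M : Type w} (R : M → M → Prop) : setLang.Structure M where
  funMap := fun f => nomatch f
  RelMap := fun r =>
    match r with
    | SetRel.mem => fun v => R (v 0) (v 1)

/-! In the sentences below the variables `&0, &1, &2, &3` are bound by the successive quantifiers
from the outside inwards. -/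

/-- `∃ x ∀ y, y ∉ x`. -/
def axEmpty : setLang.Sentence :=
  ∃' ∀' ∼(memF &1 &0)

/-- Adjunction: `∀ x y ∃ z ∀ u, u ∈ z ↔ (u ∈ x ∨ u = y)`. -/
def axW : setLang.Sentence :=
  ∀' ∀' ∃' ∀' ((memF &3 &2).iff (memF &3 &0 ⊔ (&3 =' &1)))

/-- Subtraction: `∀ x y ∃ z ∀ u, u ∈ z ↔ (u ∈ x ∧ u ≠ y)`. -/
def axD : setLang.Sentence :=
  ∀' ∀' ∃' ∀' ((memF &3 &2).iff (memF &3 &0 ⊓ ∼(&3 =' &1)))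

/-- Extensionality: `∀ x y, (∀ u, u ∈ x ↔ u ∈ y) → x = y`. -/
def axEXT : setLang.Sentence :=
  ∀' ∀' ((∀' ((memF &2 &0).iff (memF &2 &1))).imp (&0 =' &1))

/-- Binary union: `∀ x y ∃ z ∀ u, u ∈ z ↔ (u ∈ x ∨ u ∈ y)`. -/
def axBU : setLang.Sentence :=
  ∀' ∀' ∃' ∀' ((memF &3 &2).iff (memF &3 &0 ⊔ memF &3 &1))

/-- Binary intersection: `∀ x y ∃ z ∀ u, u ∈ z ↔ (u ∈ x ∧ u ∈ y)`. -/
def axBI : setLang.Sentence :=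
  ∀' ∀' ∃' ∀' ((memF &3 &2).iff (memF &3 &0 ⊓ memF &3 &1))

/-- Adjunctive set theory. -/
def AS : setLang.Theory := {axEmpty, axW}

/-- Friedman's weak set theory. -/
def WD : setLang.Theory := {axW, axD}

/-- A theory `T` in a first-order language `L` is parameter-free sequential if there is an
`L`-formula `φ(x, y)` with no free variables other than `x, y` such that, for every (nonempty)
model `M` of `T`, the structure `(M, {(x, y) | M ⊨ φ(x, y)})` is a model of `AS`. -/
def IsParameterFreeSequential {L : FirstOrder.Language.{0, 0}} (T : L.Theory) : Prop :=
  ∃ φ : L.Formula (Fin 2),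
    ∀ (M : Type w) [L.Structure M] [Nonempty M], M ⊨ T →
      letI : setLang.Structure M := structureOf fun x y : M => φ.Realize ![x, y]
      M ⊨ AS

end WeakSet

namespace WeakSet

open FirstOrder FirstOrder.Language

/-! A sequential theory codes unordered pairs, so it is enough to find a model with elements `x`,
`y` such that no `z` codes `{x, y}` in any parameter-free definable way. In an extensional structure
whose sets pairwise differ finitely, closure under toggling one element gives all the axioms, since
unions and intersections are finite modifications. Such structures amalgamate freely over complete
substructures, provided that outside points do not distinguish the sets of a substructure. Iterating
the amalgamation (`exists_homogeneous_extension`) and passing to the limit makes the partial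
isomorphisms between complete substructures a back-and-forth family, hence elementary
(`BackAndForth.realize_iff`). Start with `x = {x}` and `y = {y}`; in every extension their symmetric
difference is still `{x, y}`. The substructure generated by `z` then misses `x` or `y`
(`not_mem_generated`), and an elementary map fixing `z` moves the missing point to a new one. -/

/-- An extensional membership structure in which any two sets differ by finitely many elements. -/
structure FinDiff where
  carrier : Type w
  mem : carrier → carrier → Prop
  ext : ∀ x y, (∀ u, mem u x ↔ mem u y) → x = y
  fin : ∀ x y, {u | ¬(mem u x ↔ mem u y)}.Finite

namespace FinDiff

/-! ### Embeddings and complete structures -/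

/-- An embedding of membership structures such that the elements outside of its range do not
distinguish the sets in its range. -/
structure Emb (X Y : FinDiff.{w}) where
  toFun : X.carrier → Y.carrier
  inj : Function.Injective toFun
  mem_iff : ∀ u v, Y.mem (toFun u) (toFun v) ↔ X.mem u v
  out : ∀ u, u ∉ Set.range toFun → ∀ x y, Y.mem u (toFun x) ↔ Y.mem u (toFun y)

/-- `y` is the symmetric difference of `x` and `{s}`. -/
def IsToggle (X : FinDiff.{w}) (x s y : X.carrier) : Prop :=
  ∀ u, X.mem u y ↔ ¬(X.mem u x ↔ u = s)

/-- Closure under the symmetric difference with singletons. -/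
def Complete (X : FinDiff.{w}) : Prop :=
  ∀ x s, ∃ y, X.IsToggle x s y

/-- The identity embedding. -/
def Emb.refl (X : FinDiff.{w}) : Emb X X :=
  ⟨id, Function.injective_id, fun _ _ => Iff.rfl, fun u hu => absurd ⟨u, rfl⟩ hu⟩

/-- Composition of embeddings. -/
def Emb.comp {X Y Z : FinDiff.{w}} (g : Emb Y Z) (f : Emb X Y) : Emb X Z where
  toFun := g.toFun ∘ f.toFun
  inj := g.inj.comp f.inj
  mem_iff u v := (g.mem_iff _ _).trans (f.mem_iff _ _)
  out u hu x y := by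
    by_cases h : u ∈ Set.range g.toFun
    · obtain ⟨t, rfl⟩ := h
      have ht : t ∉ Set.range f.toFun := by
        rintro ⟨s, rfl⟩
        exact hu ⟨s, rfl⟩
      simpa [g.mem_iff] using f.out t ht x y
    · exact g.out u h _ _

theorem Emb.isToggle {X Y : FinDiff.{w}} (f : Emb X Y) {x s y : X.carrier}
    (h : X.IsToggle x s y) : Y.IsToggle (f.toFun x) (f.toFun s) (f.toFun y) := by
  intro u
  by_cases hu : u ∈ Set.range f.toFun
  · obtain ⟨t, rfl⟩ := hu
    rw [f.mem_iff, f.mem_iff, f.inj.eq_iff]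
    exact h t
  · have : u ≠ f.toFun s := fun e => hu ⟨s, e.symm⟩
    have := f.out u hu x y
    tauto

theorem Complete.exists_modification {X : FinDiff.{w}} (hX : X.Complete) (x : X.carrier)
    {S : Set X.carrier} (hS : S.Finite) : ∃ y, ∀ u, X.mem u y ↔ ¬(X.mem u x ↔ u ∈ S) := by
  induction S, hS using Set.Finite.induction_on with
  | empty => exact ⟨x, by simp⟩
  | @insert a S ha _ ih =>
    obtain ⟨y, hy⟩ := ih
    obtain ⟨t, ht⟩ := hX y a
    refine ⟨t, fun u => ?_⟩
    rw [ht u, hy u, Set.mem_insert_iff]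
    by_cases h : u = a
    · subst h; tauto
    · tauto

/-- The range of an embedding of a complete structure is closed under finite modifications. -/
theorem Emb.mem_range_of_complete {X Y : FinDiff.{w}} (f : Emb X Y) (hX : X.Complete)
    (x : X.carrier) (v : Y.carrier)
    (hv : ∀ u, u ∉ Set.range f.toFun → (Y.mem u v ↔ Y.mem u (f.toFun x))) :
    v ∈ Set.range f.toFun := by
  -- Inside the range, `v` and the image of `x` differ at finitely many points; correcting `x` there
  -- within `X` yields a preimage of `v` by extensionality.
  have hfin : {t | ¬(Y.mem (f.toFun t) v ↔ Y.mem (f.toFun t) (f.toFun x))}.Finite :=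
    (Y.fin v (f.toFun x)).preimage f.inj.injOn
  obtain ⟨y, hy⟩ := hX.exists_modification x hfin
  refine ⟨y, Y.ext _ _ fun u => ?_⟩
  by_cases hu : u ∈ Set.range f.toFun
  · obtain ⟨t, rfl⟩ := hu
    have := hy t
    simp only [Set.mem_ofPred_eq, f.mem_iff] at this ⊢
    tauto
  · rw [f.out u hu y x, hv u hu]

/-! ### Direct limits -/

/-- The direct limit of a sequence of embeddings. -/
theorem exists_limit (X : ℕ → FinDiff.{w}) (f : ∀ n, Emb (X n) (X (n + 1))) :
    ∃ (Y : FinDiff.{w}) (g : ∀ n, Emb (X n) Y),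
    (∀ n x, (g (n + 1)).toFun ((f n).toFun x) = (g n).toFun x) ∧
      ∀ y, ∃ n x, (g n).toFun x = y := by
  let F : ∀ n m, n ≤ m → (X n).carrier → (X m).carrier := fun n m h =>
    Nat.leRecOn (C := fun k => (X k).carrier) h fun {k} => (f k).toFun
  have F_self : ∀ n h x, F n n h x = x := fun n h x =>
    Nat.leRecOn_self (C := fun k => (X k).carrier) x
  have F_succ : ∀ n m h h' x, F n (m + 1) h' x = (f m).toFun (F n m h x) :=
    fun n m h h' x => Nat.leRecOn_succ (C := fun k => (X k).carrier) h x
  have F_trans : ∀ n m k h h' h'' x, F m k h' (F n m h x) = F n k h'' x :=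
    fun n m k h h' h'' x => (Nat.leRecOn_trans (C := fun k => (X k).carrier) h h' x).symm
  have F_emb : ∀ n m h, ∃ e : Emb (X n) (X m), e.toFun = F n m h := by
    intro n m h
    induction m, h using Nat.le_induction with
    | base => exact ⟨Emb.refl _, funext fun x => (F_self n _ x).symm⟩
    | succ m hm ih =>
      obtain ⟨e, he⟩ := ih
      refine ⟨(f m).comp e, funext fun x => ?_⟩
      rw [F_succ n m hm]
      simp [Emb.comp, he]
  let s : Setoid (Σ n, (X n).carrier) :=
    { r := fun a b => ∃ k, ∃ (ha : a.1 ≤ k) (hb : b.1 ≤ k), F a.1 k ha a.2 = F b.1 k hb b.2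
      iseqv := by
        refine ⟨fun a => ⟨a.1, le_rfl, le_rfl, rfl⟩, fun ⟨k, ha, hb, h⟩ => ⟨k, hb, ha, h.symm⟩, ?_⟩
        rintro a b c ⟨k, ha, hb, h⟩ ⟨l, hb', hc, h'⟩
        have hk : k ≤ max k l := le_max_left _ _
        have hl : l ≤ max k l := le_max_right _ _
        refine ⟨max k l, ha.trans hk, hc.trans hl, ?_⟩
        rw [← F_trans _ k _ ha hk, h, F_trans _ _ _ _ _ (hb.trans hk),
          ← F_trans c.1 l _ hc hl, ← h', F_trans _ _ _ _ _ (hb.trans hk)] }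
  let q : ∀ n, (X n).carrier → Quotient s := fun n x => Quotient.mk s ⟨n, x⟩
  have q_F : ∀ n m h x, q m (F n m h x) = q n x := fun n m h x =>
    Quotient.sound ⟨m, le_rfl, h, F_self _ _ _⟩
  have q_inj : ∀ n, Function.Injective (q n) := by
    intro n x y h
    obtain ⟨k, ha, hb, h⟩ := Quotient.exact h
    obtain ⟨e, he⟩ := F_emb n k ha
    exact e.inj (by rw [he]; exact h)
  have q_surj : ∀ y, ∃ n x, q n x = y := fun y => by
    obtain ⟨⟨n, x⟩, rfl⟩ := Quotient.exists_rep y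
    exact ⟨n, x, rfl⟩
  have q_surj_ge : ∀ N y, ∃ n x, N ≤ n ∧ q n x = y := fun N y => by
    obtain ⟨n, x, rfl⟩ := q_surj y
    exact ⟨max N n, F n _ (le_max_right _ _) x, le_max_left _ _, q_F _ _ _ _⟩
  let mem : Quotient s → Quotient s → Prop := fun a b =>
    ∃ n u v, q n u = a ∧ q n v = b ∧ (X n).mem u v
  have F_mem : ∀ n m h u v, (X m).mem (F n m h u) (F n m h v) ↔ (X n).mem u v := by
    intro n m h u v
    obtain ⟨e, he⟩ := F_emb n m h
    rw [← he, e.mem_iff]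
  have q_mem : ∀ n u v, mem (q n u) (q n v) ↔ (X n).mem u v := by
    intro n u v
    refine ⟨?_, fun h => ⟨n, u, v, rfl, rfl, h⟩⟩
    rintro ⟨m, u', v', hu, hv, h⟩
    have hn : n ≤ max n m := le_max_left _ _
    have hm : m ≤ max n m := le_max_right _ _
    rw [← q_F m _ hm, ← q_F n _ hn] at hu hv
    rw [← F_mem _ _ hn, ← q_inj _ hu, ← q_inj _ hv, F_mem]
    exact h
  have q_out : ∀ n u, u ∉ Set.range (q n) → ∀ x y, mem u (q n x) ↔ mem u (q n y) := by
    intro n u hu x y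
    obtain ⟨m, t, hm, rfl⟩ := q_surj_ge n u
    obtain ⟨e, he⟩ := F_emb n m hm
    have ht : t ∉ Set.range e.toFun := by
      rintro ⟨r, rfl⟩
      exact hu ⟨r, by rw [he, q_F]⟩
    rw [← q_F n m hm x, ← q_F n m hm y, q_mem, q_mem, ← he]
    exact e.out t ht x y
  have common : ∀ a b, ∃ n x y, q n x = a ∧ q n y = b := by
    intro a b
    obtain ⟨n, x, rfl⟩ := q_surj a
    obtain ⟨m, y, hm, rfl⟩ := q_surj_ge n b
    exact ⟨m, F n m hm x, y, q_F _ _ _ _, rfl⟩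
  refine ⟨⟨Quotient s, mem, ?_, ?_⟩, fun n => ⟨q n, q_inj n, q_mem n, q_out n⟩, ?_, q_surj⟩
  · intro a b h
    obtain ⟨n, x, y, rfl, rfl⟩ := common a b
    exact congrArg (q n) ((X n).ext x y fun u => by rw [← q_mem, h, q_mem])
  · intro a b
    obtain ⟨n, x, y, rfl, rfl⟩ := common a b
    refine (((X n).fin x y).image (q n)).subset fun u hu => ?_
    by_cases h : u ∈ Set.range (q n)
    · obtain ⟨t, rfl⟩ := h
      refine ⟨t, ?_, rfl⟩
      simpa [q_mem] using hu
    · exact absurd (q_out n u h x y) hu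
  · intro n x
    have := q_F n (n + 1) n.le_succ x
    rwa [F_succ n n le_rfl, F_self] at this

/-! ### Completion by iterated finite modifications -/

/-- The structure of all finite modifications of the sets of `X`. -/
def modifications (X : FinDiff.{w}) : FinDiff.{w} where
  carrier := {B : Set X.carrier // ∃ x, {u | ¬(u ∈ B ↔ X.mem u x)}.Finite}
  mem B C := ∃ u ∈ C.1, {t | X.mem t u} = B.1
  ext := by
    intro B C h
    -- The only possible members are extensions of elements of `X`, so testing against these
    -- recovers the underlying set.
    have key : ∀ (B C : {B : Set X.carrier // ∃ x, {u | ¬(u ∈ B ↔ X.mem u x)}.Finite}),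
        (∀ A : {B : Set X.carrier // ∃ x, {u | ¬(u ∈ B ↔ X.mem u x)}.Finite},
          (∃ u ∈ B.1, {t | X.mem t u} = A.1) ↔ ∃ u ∈ C.1, {t | X.mem t u} = A.1) → B.1 ⊆ C.1 := by
      intro B C h u hu
      obtain ⟨v, hv, e⟩ := (h ⟨{t | X.mem t u}, u, by simp⟩).1 ⟨u, hu, rfl⟩
      rwa [← X.ext v u fun t => Set.ext_iff.1 e t]
    exact Subtype.ext ((key B C h).antisymm (key C B fun A => (h A).symm))
  fin := by
    rintro ⟨B, x, hB⟩ ⟨C, y, hC⟩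
    have hfin : {u | ¬(u ∈ B ↔ u ∈ C)}.Finite := by
      refine ((hB.union hC).union (X.fin x y)).subset fun u hu => ?_
      simp only [Set.mem_union, Set.mem_ofPred_eq] at hu ⊢
      tauto
    refine (hfin.image fun u => ⟨{t | X.mem t u}, u, by simp⟩).subset ?_
    rintro ⟨A, a, hA⟩ h
    simp only [Set.mem_ofPred_eq] at h
    by_cases hu : ∃ u, {t | X.mem t u} = A
    · obtain ⟨u, rfl⟩ := hu
      have : ∀ D : Set X.carrier, (∃ v ∈ D, {t | X.mem t v} = {t | X.mem t u}) ↔ u ∈ D := by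
        refine fun D => ⟨?_, fun h => ⟨u, h, rfl⟩⟩
        rintro ⟨v, hv, e⟩
        rwa [← X.ext v u fun t => Set.ext_iff.1 e t]
      rw [this, this] at h
      exact ⟨u, h, rfl⟩
    · exact absurd ⟨fun ⟨u, _, e⟩ => (hu ⟨u, e⟩).elim, fun ⟨u, _, e⟩ => (hu ⟨u, e⟩).elim⟩ h

/-- The embedding of `X` into its finite modifications. -/
def toModifications (X : FinDiff.{w}) : Emb X X.modifications where
  toFun x := ⟨{t | X.mem t x}, x, by simp⟩
  inj x y h := X.ext x y fun t => Set.ext_iff.1 (congrArg Subtype.val h) t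
  mem_iff u v := by
    refine ⟨?_, fun h => ⟨u, h, rfl⟩⟩
    rintro ⟨t, ht, e⟩
    rwa [← X.ext t u fun r => Set.ext_iff.1 e r]
  out u hu x y := by
    refine ⟨?_, ?_⟩ <;>
    · rintro ⟨t, -, e⟩
      exact (hu ⟨t, Subtype.ext e⟩).elim

theorem exists_isToggle_modifications (X : FinDiff.{w}) (x s : X.carrier) :
    ∃ y, X.modifications.IsToggle (X.toModifications.toFun x) (X.toModifications.toFun s) y := by
  refine ⟨⟨{u | ¬(X.mem u x ↔ u = s)}, x, (Set.finite_singleton s).subset fun u hu => ?_⟩,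
    fun u => ?_⟩
  · simp only [Set.mem_ofPred_eq, Set.mem_singleton_iff] at hu ⊢
    tauto
  · by_cases hu : u ∈ Set.range X.toModifications.toFun
    · obtain ⟨t, rfl⟩ := hu
      rw [X.toModifications.mem_iff, X.toModifications.inj.eq_iff]
      refine ⟨?_, fun h => ⟨t, h, rfl⟩⟩
      rintro ⟨r, hr, e⟩
      rwa [← X.ext r t fun r' => Set.ext_iff.1 e r']
    · have h : ∀ B, ¬X.modifications.mem u B := by
        rintro B ⟨t, -, e⟩
        exact hu ⟨t, Subtype.ext e⟩
      have h' : u ≠ X.toModifications.toFun s := fun e => hu ⟨s, e.symm⟩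
      exact ⟨fun k => (h _ k).elim, fun k => (k (iff_of_false (h _) h')).elim⟩

theorem exists_emb_of_le {X : ℕ → FinDiff.{w}} {f : ∀ n, Emb (X n) (X (n + 1))} {Y : FinDiff.{w}}
    {g : ∀ n, Emb (X n) Y}
    (hgf : ∀ n x, (g (n + 1)).toFun ((f n).toFun x) = (g n).toFun x) {n m : ℕ} (h : n ≤ m) :
    ∃ e : Emb (X n) (X m), ∀ x, (g m).toFun (e.toFun x) = (g n).toFun x := by
  induction m, h using Nat.le_induction with
  | base => exact ⟨Emb.refl _, fun _ => rfl⟩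
  | succ m _ ih =>
    obtain ⟨e, he⟩ := ih
    exact ⟨(f m).comp e, fun x => (hgf m _).trans (he x)⟩

/-- Two elements of the limit live in a common stage, so it suffices that each toggle appears one
stage later. -/
theorem complete_of_limit {X : ℕ → FinDiff.{w}} {f : ∀ n, Emb (X n) (X (n + 1))} {Y : FinDiff.{w}}
    {g : ∀ n, Emb (X n) Y}
    (hgf : ∀ n x, (g (n + 1)).toFun ((f n).toFun x) = (g n).toFun x)
    (hg : ∀ y, ∃ n x, (g n).toFun x = y)
    (hX : ∀ n x s, ∃ y, (X (n + 1)).IsToggle ((f n).toFun x) ((f n).toFun s) y) :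
    Y.Complete := by
  intro a b
  obtain ⟨n, x, rfl⟩ := hg a
  obtain ⟨m, s, rfl⟩ := hg b
  obtain ⟨e, he⟩ := exists_emb_of_le hgf (le_max_left n m)
  obtain ⟨e', he'⟩ := exists_emb_of_le hgf (le_max_right n m)
  obtain ⟨y, hy⟩ := hX _ (e.toFun x) (e'.toFun s)
  refine ⟨(g _).toFun y, ?_⟩
  have := (g _).isToggle hy
  rwa [hgf, hgf, he, he'] at this

theorem exists_complete (X : FinDiff.{w}) : ∃ Y : FinDiff.{w}, Y.Complete ∧ Nonempty (Emb X Y) := by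
  let C : ℕ → FinDiff.{w} := fun n => Nat.rec X (fun _ Z => Z.modifications) n
  let f : ∀ n, Emb (C n) (C (n + 1)) := fun n => (C n).toModifications
  obtain ⟨Y, g, hgf, hg⟩ := exists_limit C f
  exact ⟨Y, complete_of_limit hgf hg fun n => exists_isToggle_modifications (C n), ⟨g 0⟩⟩

/-! ### Free amalgamation along partial embeddings -/

/-- A map that is an embedding of a closed nonempty subset of `X` into `X`. -/
structure PartialEmb (X : FinDiff.{w}) where
  dom : Set X.carrier
  map : X.carrier → X.carrier
  base : X.carrier
  base_mem : base ∈ dom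
  inj : Set.InjOn map dom
  mem_iff : ∀ u ∈ dom, ∀ v ∈ dom, X.mem (map u) (map v) ↔ X.mem u v
  out : ∀ u, u ∉ map '' dom → ∀ v ∈ dom, X.mem u (map v) ↔ X.mem u (map base)
  mem_dom_iff : ∀ v, v ∈ dom ↔ ∀ u ∉ dom, X.mem u v ↔ X.mem u base

/-- The membership relation of the free amalgam of `X` with copies of `X`, one for each partial
embedding `f`, glued along `f`. -/
def amalgamMem (X : FinDiff.{w}) :
    X.carrier ⊕ {p : X.PartialEmb × X.carrier // p.2 ∉ p.1.dom} →
      X.carrier ⊕ {p : X.PartialEmb × X.carrier // p.2 ∉ p.1.dom} → Prop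
  | .inl u, .inl v => X.mem u v
  | .inr p, .inl _ => X.mem p.1.2 p.1.1.base
  | .inl u, .inr q => (∃ b ∈ q.1.1.dom, q.1.1.map b = u ∧ X.mem b q.1.2) ∨
      (u ∉ q.1.1.map '' q.1.1.dom ∧ X.mem u (q.1.1.map q.1.1.base))
  | .inr p, .inr q => (p.1.1 = q.1.1 ∧ X.mem p.1.2 q.1.2) ∨
      (p.1.1 ≠ q.1.1 ∧ X.mem p.1.2 p.1.1.base)

open Classical in
/-- The inclusion of the copy of `X` that is glued along `f`. -/
noncomputable def PartialEmb.copy {X : FinDiff.{w}} (f : X.PartialEmb) (x : X.carrier) :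
    X.carrier ⊕ {p : X.PartialEmb × X.carrier // p.2 ∉ p.1.dom} :=
  if h : x ∈ f.dom then .inl (f.map x) else .inr ⟨(f, x), h⟩

namespace PartialEmb

variable {X : FinDiff.{w}} (f : X.PartialEmb)

theorem copy_of_mem {x : X.carrier} (h : x ∈ f.dom) : f.copy x = .inl (f.map x) := by
  simp [copy, h]

theorem copy_of_notMem {x : X.carrier} (h : x ∉ f.dom) : f.copy x = .inr ⟨(f, x), h⟩ := by
  simp [copy, h]

theorem copy_injective : Function.Injective f.copy := by
  intro x y h
  by_cases hx : x ∈ f.dom <;> by_cases hy : y ∈ f.dom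
  · rw [f.copy_of_mem hx, f.copy_of_mem hy] at h
    exact f.inj hx hy (Sum.inl_injective h)
  · rw [f.copy_of_mem hx, f.copy_of_notMem hy] at h
    cases h
  · rw [f.copy_of_notMem hx, f.copy_of_mem hy] at h
    cases h
  · rw [f.copy_of_notMem hx, f.copy_of_notMem hy] at h
    cases h
    rfl

theorem amalgamMem_copy (u v : X.carrier) :
    X.amalgamMem (f.copy u) (f.copy v) ↔ X.mem u v := by
  by_cases hu : u ∈ f.dom <;> by_cases hv : v ∈ f.dom
  · simpa [f.copy_of_mem hu, f.copy_of_mem hv, amalgamMem] using f.mem_iff u hu v hv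
  · rw [f.copy_of_mem hu, f.copy_of_notMem hv]
    simp only [amalgamMem]
    constructor
    · rintro (⟨b, hb, e, h⟩ | ⟨h, -⟩)
      · rwa [← f.inj hb hu e]
      · exact absurd ⟨u, hu, rfl⟩ h
    · exact fun h => .inl ⟨u, hu, rfl, h⟩
  · simpa [f.copy_of_notMem hu, f.copy_of_mem hv, amalgamMem] using
      (((f.mem_dom_iff v).1 hv) u hu).symm
  · simp [f.copy_of_notMem hu, f.copy_of_notMem hv, amalgamMem]

/-- Points outside a copy treat all its sets as they treat the base point; this is the `out`
condition for the copy. -/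
theorem amalgamMem_copy_of_notMem_range (p : X.carrier ⊕ {p : X.PartialEmb × X.carrier // p.2 ∉ p.1.dom})
    (hp : p ∉ Set.range f.copy) (x : X.carrier) :
    X.amalgamMem p (f.copy x) ↔ X.amalgamMem p (.inl (f.map f.base)) := by
  rcases p with u | p
  · have hu : u ∉ f.map '' f.dom := by
      rintro ⟨b, hb, rfl⟩
      exact hp ⟨b, f.copy_of_mem hb⟩
    by_cases hx : x ∈ f.dom
    · rw [f.copy_of_mem hx]
      exact f.out u hu x hx
    · rw [f.copy_of_notMem hx]
      simp only [amalgamMem]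
      refine ⟨?_, fun h => .inr ⟨hu, h⟩⟩
      rintro (⟨b, hb, e, -⟩ | ⟨-, h⟩)
      · exact absurd ⟨b, hb, e⟩ hu
      · exact h
  · have hne : p.1.1 ≠ f := by
      rintro rfl
      exact hp ⟨p.1.2, copy_of_notMem _ p.2⟩
    by_cases hx : x ∈ f.dom
    · rw [f.copy_of_mem hx]
      rfl
    · rw [f.copy_of_notMem hx]
      simp [amalgamMem, hne]

end PartialEmb

/-- The free amalgam of `X` with copies of `X`, one for each partial embedding `f`, glued
along `f`. -/
def amalgam (X : FinDiff.{w}) : FinDiff.{w} where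
  carrier := X.carrier ⊕ {p : X.PartialEmb × X.carrier // p.2 ∉ p.1.dom}
  mem := X.amalgamMem
  ext := by
    -- By `mem_dom_iff`, a new point is told apart from the base by another new point of its own
    -- copy. Old points and other copies see that new point only through the base, whence
    -- extensionality.
    have key : ∀ (q : {p : X.PartialEmb × X.carrier // p.2 ∉ p.1.dom}),
        ∃ (u : X.carrier) (hu : u ∉ q.1.1.dom),
          ¬(X.amalgamMem (.inr ⟨(q.1.1, u), hu⟩) (.inr q) ↔ X.mem u q.1.1.base) := by
      rintro ⟨⟨f, v⟩, hv⟩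
      obtain ⟨u, hu, h⟩ : ∃ u, u ∉ f.dom ∧ ¬(X.mem u v ↔ X.mem u f.base) := by
        by_contra! h
        exact hv ((f.mem_dom_iff v).2 h)
      exact ⟨u, hu, by simpa [amalgamMem] using h⟩
    rintro (x | p) (y | q) h
    · rw [X.ext x y fun u => h (.inl u)]
    · obtain ⟨u, hu, hq⟩ := key q
      exact absurd (h _).symm hq
    · obtain ⟨u, hu, hp⟩ := key p
      exact absurd (h _) hp
    · by_cases e : p.1.1 = q.1.1
      · obtain ⟨⟨f, x⟩, hx⟩ := p
        obtain ⟨⟨g, y⟩, hy⟩ := q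
        obtain rfl : f = g := e
        rw [← f.copy_of_notMem hx, ← f.copy_of_notMem hy] at h ⊢
        refine congrArg f.copy (X.ext x y fun u => ?_)
        rw [← f.amalgamMem_copy u x, ← f.amalgamMem_copy u y, h]
      · obtain ⟨u, hu, hp⟩ := key p
        refine absurd ((h _).trans ?_) hp
        simp only [amalgamMem, e, false_and, ne_eq, not_false_eq_true, true_and, false_or]
  fin := by
    have trans : ∀ a b c, {u | ¬(X.amalgamMem u a ↔ X.amalgamMem u b)}.Finite →
        {u | ¬(X.amalgamMem u c ↔ X.amalgamMem u b)}.Finite →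
        {u | ¬(X.amalgamMem u a ↔ X.amalgamMem u c)}.Finite := by
      intro a b c hab hcb
      refine (hab.union hcb).subset fun u hu => ?_
      simp only [Set.mem_union, Set.mem_ofPred_eq] at hu ⊢
      tauto
    have inl_inl : ∀ x y, {u | ¬(X.amalgamMem u (.inl x) ↔ X.amalgamMem u (.inl y))}.Finite := by
      intro x y
      refine ((X.fin x y).image .inl).subset ?_
      rintro (u | p) hu
      · exact ⟨u, hu, rfl⟩
      · exact absurd Iff.rfl hu
    -- A new point differs from the glued base only inside its copy, where finiteness comes from
    -- `X`.
    have to_inl : ∀ a, ∃ x, {u | ¬(X.amalgamMem u a ↔ X.amalgamMem u (.inl x))}.Finite := by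
      rintro (x | ⟨⟨f, x⟩, hx⟩)
      · exact ⟨x, inl_inl x x⟩
      · refine ⟨f.map f.base, ((X.fin x f.base).image f.copy).subset fun p hp => ?_⟩
        rw [← f.copy_of_notMem hx, ← f.copy_of_mem f.base_mem] at hp
        by_cases h : p ∈ Set.range f.copy
        · obtain ⟨u, rfl⟩ := h
          refine ⟨u, ?_, rfl⟩
          simpa only [Set.mem_ofPred_eq, f.amalgamMem_copy] using hp
        · refine absurd ?_ hp
          rw [f.amalgamMem_copy_of_notMem_range p h, f.amalgamMem_copy_of_notMem_range p h]
    intro a b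
    obtain ⟨x, hx⟩ := to_inl a
    obtain ⟨y, hy⟩ := to_inl b
    exact trans a _ b hx (trans b _ _ hy (inl_inl x y))

/-- The embedding of `X` into its free amalgam with copies of `X`. -/
def toAmalgam (X : FinDiff.{w}) : Emb X X.amalgam where
  toFun := .inl
  inj := Sum.inl_injective
  mem_iff _ _ := Iff.rfl
  out := by
    rintro (u | p) hu x y
    · exact absurd ⟨u, rfl⟩ hu
    · exact Iff.rfl

/-- The embedding of the copy of `X` glued along `f` into the free amalgam. -/
noncomputable def PartialEmb.toAmalgam {X : FinDiff.{w}} (f : X.PartialEmb) :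
    Emb X X.amalgam where
  toFun := f.copy
  inj := f.copy_injective
  mem_iff := f.amalgamMem_copy
  out p hp x y := (f.amalgamMem_copy_of_notMem_range p hp x).trans (f.amalgamMem_copy_of_notMem_range p hp y).symm

/-- Turns `(Z, α, β)` into an index for the amalgam that stays in universe `w`. Completeness of `Z`
makes the range of `α` closed. -/
theorem exists_partialEmb {X Z : FinDiff.{w}} (hZ : Z.Complete) (z₀ : Z.carrier)
    (α β : Emb Z X) :
    ∃ f : X.PartialEmb, f.dom = Set.range α.toFun ∧ ∀ z, f.map (α.toFun z) = β.toFun z := by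
  have : Nonempty Z.carrier := ⟨z₀⟩
  have hinv : ∀ z, Function.invFun α.toFun (α.toFun z) = z :=
    Function.leftInverse_invFun α.inj
  refine ⟨⟨Set.range α.toFun, fun x => β.toFun (Function.invFun α.toFun x), α.toFun z₀,
    ⟨z₀, rfl⟩, ?_, ?_, ?_, ?_⟩, rfl, fun z => by simp only [hinv]⟩
  · rintro _ ⟨x, rfl⟩ _ ⟨y, rfl⟩ h
    simp only [hinv] at h
    rw [β.inj h]
  · rintro _ ⟨x, rfl⟩ _ ⟨y, rfl⟩
    simp only [hinv, α.mem_iff, β.mem_iff]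
  · rintro u hu _ ⟨x, rfl⟩
    simp only [hinv]
    refine β.out u ?_ _ _
    rintro ⟨z, rfl⟩
    exact hu ⟨α.toFun z, ⟨z, rfl⟩, by simp only [hinv]⟩
  · refine fun v => ⟨?_, fun h => α.mem_range_of_complete hZ z₀ v h⟩
    rintro ⟨z, rfl⟩ u hu
    exact α.out u hu _ _

/-- Every structure has a complete extension in which every partial embedding with complete domain
extends to an embedding of the whole structure that is as free as possible. -/
theorem exists_homogeneous_extension (X : FinDiff.{w}) :
    ∃ (Y : FinDiff.{w}) (ι : Emb X Y), Y.Complete ∧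
      ∀ (Z : FinDiff.{w}), Z.Complete → Nonempty Z.carrier → ∀ α β : Emb Z X, ∃ γ : Emb X Y,
        (∀ z, γ.toFun (α.toFun z) = ι.toFun (β.toFun z)) ∧
          ∀ x, γ.toFun x ∈ Set.range ι.toFun → x ∈ Set.range α.toFun := by
  obtain ⟨Y, hY, ⟨c⟩⟩ := exists_complete X.amalgam
  refine ⟨Y, c.comp X.toAmalgam, hY, ?_⟩
  rintro Z hZ ⟨z₀⟩ α β
  obtain ⟨f, hdom, hmap⟩ := exists_partialEmb hZ z₀ α β
  refine ⟨c.comp f.toAmalgam, fun z => ?_, ?_⟩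
  · have : f.copy (α.toFun z) = .inl (β.toFun z) := by
      rw [f.copy_of_mem (by rw [hdom]; exact ⟨z, rfl⟩), hmap]
    exact congrArg c.toFun this
  · rintro x ⟨y, hy⟩
    have : Sum.inl y = f.copy x := c.inj hy
    rw [← hdom]
    by_contra hx
    rw [f.copy_of_notMem hx] at this
    cases this

/-! ### The pair to be separated, and substructures generated by one element -/

/-- The structure of two elements `x = {x}` and `y = {y}`. -/
def twoPoints : FinDiff.{w} where
  carrier := ULift Bool
  mem u v := u = v
  ext x _ h := (h x).1 rfl
  fin _ _ := Set.toFinite _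

/-- Elements that are obtained from `z` by repeated finite modifications. -/
def generated (X : FinDiff.{w}) (z : X.carrier) : ℕ → Set X.carrier
  | 0 => {z}
  | n + 1 => {v | ∀ u, ¬(X.mem u v ↔ X.mem u z) → u ∈ X.generated z n}

theorem generated_subset_succ (X : FinDiff.{w}) (z : X.carrier) (n : ℕ) :
    X.generated z n ⊆ X.generated z (n + 1) := by
  induction n with
  | zero =>
    rintro v rfl u hu
    exact absurd Iff.rfl hu
  | succ n ih => exact fun v hv u hu => ih (hv u hu)

theorem generated_mono (X : FinDiff.{w}) (z : X.carrier) : Monotone (X.generated z) :=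
  monotone_nat_of_le_succ (X.generated_subset_succ z)

/-- Two elements whose symmetric difference is the pair of them are not generated by one
element. -/
theorem not_mem_generated {X : FinDiff.{w}} {x y : X.carrier} (hxy : x ≠ y)
    (h : ∀ u, u = x ∨ u = y → ¬(X.mem u x ↔ X.mem u y)) (z : X.carrier) (n : ℕ) :
    ¬(x ∈ X.generated z n ∧ y ∈ X.generated z n) := by
  induction n with
  | zero =>
    rintro ⟨rfl, rfl⟩
    exact hxy rfl
  | succ n ih =>
    rintro ⟨hx, hy⟩
    -- A point distinguishing `x` from `y` distinguishes one of them from `z`, so it already occurs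
    -- one level lower.
    have : ∀ u, u = x ∨ u = y → u ∈ X.generated z n := by
      intro u hu
      have hu := h u hu
      by_cases hux : X.mem u x ↔ X.mem u z
      · exact hy u (by tauto)
      · exact hx u hux
    exact ih ⟨this x (.inl rfl), this y (.inr rfl)⟩

/-- In a complete structure, the elements generated by `z` form the range of an embedding of a
complete structure. -/
theorem Complete.exists_emb_generated {X : FinDiff.{w}} (hX : X.Complete) (z : X.carrier) :
    ∃ (Z : FinDiff.{w}) (α : Emb Z X), Z.Complete ∧ z ∈ Set.range α.toFun ∧
      ∀ v, v ∈ Set.range α.toFun → ∃ n, v ∈ X.generated z n := by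
  have hout : ∀ v, (∃ n, v ∈ X.generated z n) → ∀ u, (¬∃ n, u ∈ X.generated z n) →
      (X.mem u v ↔ X.mem u z) := by
    rintro v ⟨n, hv⟩ u hu
    by_contra h
    exact hu ⟨n, X.generated_subset_succ z n hv u h⟩
  refine ⟨⟨{v // ∃ n, v ∈ X.generated z n}, fun u v => X.mem u v, ?_, ?_⟩,
    ⟨Subtype.val, Subtype.val_injective, fun _ _ => Iff.rfl, ?_⟩, ?_, ⟨⟨z, 0, rfl⟩, rfl⟩, ?_⟩
  · rintro ⟨x, hx⟩ ⟨y, hy⟩ h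
    refine Subtype.ext (X.ext x y fun u => ?_)
    by_cases hu : ∃ n, u ∈ X.generated z n
    · exact h ⟨u, hu⟩
    · rw [hout x hx u hu, hout y hy u hu]
  · exact fun x y => (X.fin x y).preimage Subtype.val_injective.injOn
  · intro u hu x y
    have hu : ¬∃ n, u ∈ X.generated z n := fun h => hu ⟨⟨u, h⟩, rfl⟩
    rw [hout x x.2 u hu, hout y y.2 u hu]
  · rintro ⟨x, n, hx⟩ ⟨s, m, hs⟩
    obtain ⟨y, hy⟩ := hX x s
    -- The toggle differs from `z` only at `s`, of level `m`, and where `x` does, at points of level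
    -- `n`.
    refine ⟨⟨y, max n m + 1, fun u hu => ?_⟩, fun u => (hy u).trans (by simp [Subtype.ext_iff])⟩
    by_cases e : u = s
    · exact e ▸ X.generated_mono z (le_max_right n m) hs
    · refine X.generated_mono z (le_max_left n m) (X.generated_subset_succ z n hx u ?_ )
      have := hy u
      tauto
  · rintro _ ⟨v, rfl⟩
    exact v.2

end FinDiff

/-! ### Back-and-forth families and the meaning of the axioms -/

/-- A family of partial maps, given by their graphs, with the back-and-forth property. -/
structure BackAndForth {M : Type w} (ℱ : Set (Set (M × M))) : Prop where
  inj : ∀ G ∈ ℱ, ∀ p ∈ G, ∀ q ∈ G, p.1 = q.1 ↔ p.2 = q.2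
  forth : ∀ G ∈ ℱ, ∀ u, ∃ G' ∈ ℱ, G ⊆ G' ∧ ∃ v, (u, v) ∈ G'
  back : ∀ G ∈ ℱ, ∀ v, ∃ G' ∈ ℱ, G ⊆ G' ∧ ∃ u, (u, v) ∈ G'

theorem term_eq_var {α : Type} (t : setLang.Term α) : ∃ a, t = Term.var a := by
  cases t with
  | var a => exact ⟨a, rfl⟩
  | func f _ => exact nomatch f

/-- A back-and-forth family of partial isomorphisms consists of partial elementary maps. -/
theorem BackAndForth.realize_iff {M : Type w} {ℱ : Set (Set (M × M))} (hℱ : BackAndForth ℱ)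
    (R : M → M → Prop) (hR : ∀ G ∈ ℱ, ∀ p ∈ G, ∀ q ∈ G, R p.1 q.1 ↔ R p.2 q.2) {α : Type} {n : ℕ}
    (φ : setLang.BoundedFormula α n) {G : Set (M × M)} (hG : G ∈ ℱ) (v v' : α → M)
    (xs xs' : Fin n → M) (hv : ∀ a, (v a, v' a) ∈ G) (hxs : ∀ i, (xs i, xs' i) ∈ G) :
    letI : setLang.Structure M := structureOf R
    φ.Realize v xs ↔ φ.Realize v' xs' := by
  let : setLang.Structure M := structureOf R
  induction φ generalizing G with
  | falsum => exact Iff.rfl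
  | equal t₁ t₂ =>
    obtain ⟨a, rfl⟩ := term_eq_var t₁
    obtain ⟨b, rfl⟩ := term_eq_var t₂
    have h : ∀ a, (Sum.elim v xs a, Sum.elim v' xs' a) ∈ G := by rintro (a | i) <;> simp [hv, hxs]
    exact hℱ.inj G hG _ (h a) _ (h b)
  | rel r ts =>
    cases r
    obtain ⟨a, ha⟩ := term_eq_var (ts 0)
    obtain ⟨b, hb⟩ := term_eq_var (ts 1)
    have h : ∀ a, (Sum.elim v xs a, Sum.elim v' xs' a) ∈ G := by rintro (a | i) <;> simp [hv, hxs]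
    change R ((ts 0).realize _) ((ts 1).realize _) ↔ R ((ts 0).realize _) ((ts 1).realize _)
    rw [ha, hb]
    exact hR G hG _ (h a) _ (h b)
  | imp φ ψ ihφ ihψ => exact imp_congr (ihφ hG _ _ hv hxs) (ihψ hG _ _ hv hxs)
  | all φ ih =>
    have snoc : ∀ G' : Set (M × M), G ⊆ G' → ∀ u u', (u, u') ∈ G' →
        ∀ i, ((Fin.snoc xs u : Fin _ → M) i, (Fin.snoc xs' u' : Fin _ → M) i) ∈ G' := by
      intro G' hGG' u u' hu i
      refine Fin.lastCases ?_ (fun i => ?_) i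
      · simpa using hu
      · simpa using hGG' (hxs i)
    constructor
    · intro h u'
      obtain ⟨G', hG', hGG', u, hu⟩ := hℱ.back G hG u'
      exact (ih hG' _ _ (fun a => hGG' (hv a)) (snoc G' hGG' u u' hu)).1 (h u)
    · intro h u
      obtain ⟨G', hG', hGG', u', hu⟩ := hℱ.forth G hG u
      exact (ih hG' _ _ (fun a => hGG' (hv a)) (snoc G' hGG' u u' hu)).2 (h u')

theorem realize_memF {M : Type w} (R : M → M → Prop) {α : Type} {n : ℕ}
    (t₁ t₂ : setLang.Term (α ⊕ Fin n)) (v : α → M) (xs : Fin n → M) :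
    letI : setLang.Structure M := structureOf R
    (memF t₁ t₂).Realize v xs ↔
      R (t₁.realize (Sum.elim v xs)) (t₂.realize (Sum.elim v xs)) :=
  Iff.rfl

theorem models_axW_iff {M : Type w} (R : M → M → Prop) :
    letI : setLang.Structure M := structureOf R
    M ⊨ axW ↔ ∀ x y, ∃ z, ∀ u, R u z ↔ R u x ∨ u = y := by
  simp [axW, realize_memF, Sentence.Realize, Formula.Realize, Fin.snoc]

theorem models_axD_iff {M : Type w} (R : M → M → Prop) :
    letI : setLang.Structure M := structureOf R
    M ⊨ axD ↔ ∀ x y, ∃ z, ∀ u, R u z ↔ R u x ∧ u ≠ y := by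
  simp [axD, realize_memF, Sentence.Realize, Formula.Realize, Fin.snoc]

theorem models_axEmpty_iff {M : Type w} (R : M → M → Prop) :
    letI : setLang.Structure M := structureOf R
    M ⊨ axEmpty ↔ ∃ x, ∀ y, ¬R y x := by
  simp [axEmpty, realize_memF, Sentence.Realize, Formula.Realize, Fin.snoc]

theorem models_axEXT_iff {M : Type w} (R : M → M → Prop) :
    letI : setLang.Structure M := structureOf R
    M ⊨ axEXT ↔ ∀ x y, (∀ u, R u x ↔ R u y) → x = y := by
  simp [axEXT, realize_memF, Sentence.Realize, Formula.Realize, Fin.snoc]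

theorem models_axBU_iff {M : Type w} (R : M → M → Prop) :
    letI : setLang.Structure M := structureOf R
    M ⊨ axBU ↔ ∀ x y, ∃ z, ∀ u, R u z ↔ R u x ∨ R u y := by
  simp [axBU, realize_memF, Sentence.Realize, Formula.Realize, Fin.snoc]

theorem models_axBI_iff {M : Type w} (R : M → M → Prop) :
    letI : setLang.Structure M := structureOf R
    M ⊨ axBI ↔ ∀ x y, ∃ z, ∀ u, R u z ↔ R u x ∧ R u y := by
  simp [axBI, realize_memF, Sentence.Realize, Formula.Realize, Fin.snoc]

theorem IsParameterFreeSequential.mono {L : FirstOrder.Language.{0, 0}} {T T' : L.Theory}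
    (hT : T ⊆ T') (h : IsParameterFreeSequential.{w} T) : IsParameterFreeSequential.{w} T' := by
  obtain ⟨φ, hφ⟩ := h
  exact ⟨φ, fun M _ _ hM => hφ M (hM.mono hT)⟩

/-! ### The homogeneous model and the conclusion -/

namespace FinDiff

/-- The axioms hold in complete structures. -/
theorem Complete.models {X : FinDiff.{w}} (hX : X.Complete) :
    letI : setLang.Structure X.carrier := structureOf X.mem
    X.carrier ⊨ (WD ∪ {axEXT, axBU, axBI} : setLang.Theory) := by
  let : setLang.Structure X.carrier := structureOf X.mem
  simp only [WD, Theory.model_iff, Set.mem_union, Set.mem_insert_iff, Set.mem_singleton_iff]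
  rintro _ ((rfl | rfl) | (rfl | rfl | rfl))
  · refine (models_axW_iff X.mem).2 fun x y => ?_
    obtain ⟨z, hz⟩ := hX.exists_modification x (S := {u | u = y ∧ ¬X.mem u x})
      ((Set.finite_singleton y).subset fun u hu => hu.1)
    refine ⟨z, fun u => (hz u).trans ?_⟩
    simp only [Set.mem_ofPred_eq]
    tauto
  · refine (models_axD_iff X.mem).2 fun x y => ?_
    obtain ⟨z, hz⟩ := hX.exists_modification x (S := {u | u = y ∧ X.mem u x})
      ((Set.finite_singleton y).subset fun u hu => hu.1)
    refine ⟨z, fun u => (hz u).trans ?_⟩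
    simp only [Set.mem_ofPred_eq]
    tauto
  · exact (models_axEXT_iff X.mem).2 X.ext
  · refine (models_axBU_iff X.mem).2 fun x y => ?_
    -- Only the elements of `y` missing from `x` are added, and these are finitely many.
    obtain ⟨z, hz⟩ := hX.exists_modification x (S := {u | ¬X.mem u x ∧ X.mem u y})
      ((X.fin x y).subset fun u hu => by simp only [Set.mem_ofPred_eq] at hu ⊢; tauto)
    refine ⟨z, fun u => (hz u).trans ?_⟩
    simp only [Set.mem_ofPred_eq]
    tauto
  · refine (models_axBI_iff X.mem).2 fun x y => ?_
    obtain ⟨z, hz⟩ := hX.exists_modification x (S := {u | X.mem u x ∧ ¬X.mem u y})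
      ((X.fin x y).subset fun u hu => by simp only [Set.mem_ofPred_eq] at hu ⊢; tauto)
    refine ⟨z, fun u => (hz u).trans ?_⟩
    simp only [Set.mem_ofPred_eq]
    tauto

/-- There is a complete structure with two elements `x`, `y` and a back-and-forth family of partial
isomorphisms such that every `z` is fixed by one that moves `x` or `y` outside of `{x, y}`. -/
theorem exists_homogeneous : ∃ X : FinDiff.{w}, X.Complete ∧
    ∃ ℱ : Set (Set (X.carrier × X.carrier)), BackAndForth ℱ ∧
      (∀ G ∈ ℱ, ∀ p ∈ G, ∀ q ∈ G, X.mem p.1 q.1 ↔ X.mem p.2 q.2) ∧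
      ∃ x y, ∀ z, ∃ G ∈ ℱ, (z, z) ∈ G ∧
        ∃ u v, (u = x ∨ u = y) ∧ (u, v) ∈ G ∧ v ≠ x ∧ v ≠ y := by
  obtain ⟨X₀, hX₀, ⟨e₀⟩⟩ := exists_complete twoPoints.{w}
  choose E ι hE hι using exists_homogeneous_extension.{w}
  let C : ℕ → FinDiff.{w} := fun n => Nat.rec X₀ (fun _ Z => E Z) n
  let f : ∀ n, Emb (C n) (C (n + 1)) := fun n => ι (C n)
  have hC : ∀ n, (C n).Complete := by
    rintro (_ | n)
    · exact hX₀
    · exact hE _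
  obtain ⟨M, g, hgf, hg⟩ := exists_limit C f
  have hg_ge : ∀ N y, ∃ n, N ≤ n ∧ ∃ x, (g n).toFun x = y := by
    intro N y
    obtain ⟨n, x, rfl⟩ := hg y
    obtain ⟨e, he⟩ := exists_emb_of_le hgf (le_max_left n N)
    exact ⟨_, le_max_right n N, e.toFun x, he x⟩
  let graph : ∀ {n} {Z : FinDiff.{w}} (_ _ : Emb Z (C n)), Set (M.carrier × M.carrier) :=
    fun {n Z} α β => Set.range fun z => ((g n).toFun (α.toFun z), (g n).toFun (β.toFun z))
  let ℱ : Set (Set (M.carrier × M.carrier)) :=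
    {G | ∃ (n : ℕ) (Z : FinDiff.{w}) (α β : Emb Z (C n)), Z.Complete ∧ Nonempty Z.carrier ∧
      G = graph α β}
  have forth : ∀ G ∈ ℱ, ∀ u, ∃ G' ∈ ℱ, G ⊆ G' ∧ ∃ v, (u, v) ∈ G' := by
    rintro _ ⟨n, Z, α, β, hZ, hZ', rfl⟩ u
    obtain ⟨m, hm, u, rfl⟩ := hg_ge n u
    obtain ⟨e, he⟩ := exists_emb_of_le hgf hm
    -- At a stage `m` containing `u`, the partial map extends to all of `C m`, whose completeness
    -- keeps the new graph in `ℱ`.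
    obtain ⟨γ, hγ, -⟩ := hι (C m) Z hZ hZ' (e.comp α) (e.comp β)
    refine ⟨graph (n := m + 1) (f m) γ, ⟨m + 1, C m, f m, γ, hC m, ⟨u⟩, rfl⟩, ?_,
      (g (m + 1)).toFun (γ.toFun u), u, by simp only [hgf]⟩
    rintro _ ⟨z, rfl⟩
    refine ⟨(e.comp α).toFun z, ?_⟩
    simp only [hγ]
    change ((g (m + 1)).toFun ((f m).toFun _), (g (m + 1)).toFun ((f m).toFun _)) = _
    rw [hgf, hgf]
    exact congrArg₂ Prod.mk (he _) (he _)
  have symm : ∀ G ∈ ℱ, Prod.swap ⁻¹' G ∈ ℱ := by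
    rintro _ ⟨n, Z, α, β, hZ, hZ', rfl⟩
    refine ⟨n, Z, β, α, hZ, hZ', ?_⟩
    ext ⟨a, b⟩
    simp [graph, and_comm]
  have inj : ∀ G ∈ ℱ, ∀ p ∈ G, ∀ q ∈ G, p.1 = q.1 ↔ p.2 = q.2 := by
    rintro _ ⟨n, Z, α, β, hZ, hZ', rfl⟩ _ ⟨x, rfl⟩ _ ⟨y, rfl⟩
    simp only [(g n).inj.eq_iff, α.inj.eq_iff, β.inj.eq_iff]
  have mem : ∀ G ∈ ℱ, ∀ p ∈ G, ∀ q ∈ G, M.mem p.1 q.1 ↔ M.mem p.2 q.2 := by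
    rintro _ ⟨n, Z, α, β, hZ, hZ', rfl⟩ _ ⟨x, rfl⟩ _ ⟨y, rfl⟩
    simp only [(g n).mem_iff, α.mem_iff, β.mem_iff]
  refine ⟨M, complete_of_limit hgf hg fun n _ _ => hC (n + 1) _ _, ℱ,
    ⟨inj, forth, fun G hG v => ?_⟩, mem, ?_⟩
  · obtain ⟨G', hG', hGG', u, hu⟩ := forth _ (symm G hG) v
    exact ⟨_, symm G' hG', fun p hp => hGG' (show Prod.swap p ∈ Prod.swap ⁻¹' G from hp), u, hu⟩
  · refine ⟨(g 0).toFun (e₀.toFun ⟨true⟩), (g 0).toFun (e₀.toFun ⟨false⟩), fun z => ?_⟩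
    obtain ⟨n, z, rfl⟩ := hg z
    obtain ⟨e, he⟩ := exists_emb_of_le hgf n.zero_le
    rw [← he, ← he]
    set x := e.toFun (e₀.toFun ⟨true⟩) with hx
    set y := e.toFun (e₀.toFun ⟨false⟩) with hy
    have hxy : x ≠ y := fun h => by
      have := e₀.inj (e.inj h)
      cases this
    have hdiff : ∀ u, u = x ∨ u = y → ¬((C n).mem u x ↔ (C n).mem u y) := by
      have hmem : ∀ a b : ULift Bool,
          (C n).mem (e.toFun (e₀.toFun a)) (e.toFun (e₀.toFun b)) ↔ a = b := fun a b =>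
        (e.mem_iff _ _).trans (e₀.mem_iff _ _)
      rintro u (rfl | rfl) <;> simp [hx, hy, hmem]
    obtain ⟨Z, α, hZ, ⟨z, rfl⟩, hα⟩ := (hC n).exists_emb_generated z
    obtain ⟨u, hu, hu'⟩ : ∃ u, (u = x ∨ u = y) ∧ u ∉ Set.range α.toFun := by
      by_contra! h
      obtain ⟨k, hk⟩ := hα x (h x (.inl rfl))
      obtain ⟨l, hl⟩ := hα y (h y (.inr rfl))
      exact not_mem_generated hxy hdiff (α.toFun z) (max k l)
        ⟨(C n).generated_mono _ (le_max_left k l) hk, (C n).generated_mono _ (le_max_right k l) hl⟩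
    -- Extending the identity of `Z` fixes `z`, while freeness sends `u` outside stage `n`, hence
    -- away from `x` and `y`.
    obtain ⟨γ, hγ, hγ'⟩ := hι (C n) Z hZ ⟨z⟩ α α
    have hne : ∀ t, (g (n + 1)).toFun (γ.toFun u) ≠ (g n).toFun t := by
      intro t h
      rw [← hgf n t] at h
      exact hu' (hγ' u ⟨t, ((g (n + 1)).inj h).symm⟩)
    refine ⟨graph (n := n + 1) (f n) γ, ⟨n + 1, C n, f n, γ, hC n, ⟨u⟩, rfl⟩, ⟨α.toFun z, ?_⟩,
      (g n).toFun u, (g (n + 1)).toFun (γ.toFun u), ?_, ⟨u, by simp only [hgf]⟩, hne _, hne _⟩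
    · simp only [hγ]
      change ((g (n + 1)).toFun ((f n).toFun _), (g (n + 1)).toFun ((f n).toFun _)) = _
      rw [hgf]
    · simpa only [(g n).inj.eq_iff] using hu

end FinDiff

/-- Adjoining `x` and `y` to the `R`-empty set gives `z` with exactly these `R`-elements. Elementary
maps preserve `R`, so one fixing `z` cannot move `x` or `y` out of the pair. -/
theorem not_isParameterFreeSequential :
    ¬IsParameterFreeSequential.{w} (WD ∪ {axEXT, axBU, axBI}) := by
  rintro ⟨φ, hφ⟩
  obtain ⟨X, hX, ℱ, hℱ, hmem, x, y, hxy⟩ := FinDiff.exists_homogeneous.{w}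
  let : setLang.Structure X.carrier := structureOf X.mem
  have : Nonempty X.carrier := ⟨x⟩
  set R : X.carrier → X.carrier → Prop := fun a b => φ.Realize ![a, b] with hRdef
  have hAS := hφ X.carrier hX.models
  have hR : ∀ G ∈ ℱ, ∀ p ∈ G, ∀ q ∈ G, R p.1 q.1 ↔ R p.2 q.2 := by
    intro G hG p hp q hq
    refine hℱ.realize_iff X.mem hmem φ hG ![p.1, q.1] ![p.2, q.2] default default ?_ nofun
    intro i
    fin_cases i
    · exact hp
    · exact hq
  have hW : ∀ x y, ∃ z, ∀ u, R u z ↔ R u x ∨ u = y :=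
    (models_axW_iff R).1 (@Theory.realize_sentence_of_mem _ X.carrier (structureOf R) AS hAS _
      (by simp [AS]))
  obtain ⟨o, ho⟩ : ∃ x, ∀ y, ¬R y x :=
    (models_axEmpty_iff R).1 (@Theory.realize_sentence_of_mem _ X.carrier (structureOf R) AS hAS _
      (by simp [AS]))
  obtain ⟨s, hs⟩ := hW o x
  obtain ⟨z, hz⟩ := hW s y
  have hz : ∀ u, R u z ↔ u = x ∨ u = y := fun u => by simp [hz, hs, ho]
  obtain ⟨G, hG, hzG, u, v, hu, huv, hvx, hvy⟩ := hxy z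
  have := (hz v).1 ((hR G hG _ huv _ hzG).1 ((hz u).2 hu))
  tauto

end WeakSet

theorem mainTheorem2 :
    ¬ WeakSet.IsParameterFreeSequential.{w}
        (WeakSet.WD ∪ {WeakSet.axEXT, WeakSet.axBU, WeakSet.axBI}) ∧
      ¬ WeakSet.IsParameterFreeSequential.{w} WeakSet.WD :=
  ⟨WeakSet.not_isParameterFreeSequential, fun h =>
    WeakSet.not_isParameterFreeSequential (h.mono Set.subset_union_left)⟩
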